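/- **Definitions.** Write $\log_2$ for the base-2 logarithm. For a unit vector $|\psi\rangle\in\mathbf H_X\otimes\mathbf H_Y$ (finite-dimensional) with reduced density matrix $\rho_X=\operatorname{Tr}_Y|\psi\rangle\langle\psi|$ with eigenvalues $\lambda_k$, let $C(|\psi\rangle_{X|Y})=\sqrt{2(1-\operatorname{Tr}\rho_X^2)}$ and $E_\alpha(|\psi\rangle_{X|Y})=\frac1{1-\alpha}\log_2\sum_k\lambda_k^\alpha$ for $\alpha>0$, $\alpha\neq1$, and $E_1(|\psi\rangle_{X|Y})=-\sum_k\lambda_k\log_2\lambda_k$. For a mixed state $\rho$ of $X|Y$ let $$C(\rho_{X|Y})=\min\sum_k p_k\,C(|\psi_k\rangle_{X|Y}),\qquad E^a_\alpha(\rho_{X|Y})=\max\sum_k p_k\,E_\alpha(|\psi_k\rangle_{X|Y}),$$ the minimum and the maximum being over all pure state decompositions $\rho=\sum_k p_k|\psi_k\rangle\langle\psi_k|$ (the concurrence and the Rényi-$\alpha$ entanglement of assistance). **Theorem.** Let $N\ge4$, $1\le m\le N-3$, and let $$|\psi\rangle_{AB_1\cdots B_{N-1}}=a|10\cdots0\rangle+b_1|01\cdots0\rangle+\cdots+b_{N-1}|00\cdots1\rangle,\qquad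 |a|^2+\sum_{i=1}^{N-1}|b_i|^2=1,\quad a,b_i\in\mathbb C,$$ be an $N$-qubit generalized $W$-class state, $\rho=\rho_{A|B_1\cdots B_{N-1}}=|\psi\rangle\langle\psi|$, with reduced states $\rho_{AB_i}$ and $\rho_{A|B_{i+1}\cdots B_{N-1}}$ (partial traces over the remaining qubits) and concurrences $C_{AB_i}=C(\rho_{A|B_i})$, $C_{A|B_{i+1}\cdots B_{N-1}}=C(\rho_{A|B_{i+1}\cdots B_{N-1}})$. Suppose that $$C_{AB_i}\ge C_{A|B_{i+1}\cdots B_{N-1}}\ (1\le i\le m),\qquad C_{AB_j}\le C_{A|B_{j+1}\cdots B_{N-1}}\ (m+1\le j\le N-2).$$ Then for all $0\le\mu\le1$ and $\alpha\in\left[\frac{\sqrt7-1}2,\frac{\sqrt{13}-1}2\right]$, $$[E^a_\alpha(\rho_{A|B_1\cdots B_{N-1}})]^\mu\le\sum_{i=1}^{m}(2^\mu-1)^{i-1}[E^a_\alpha(\rho_{AB_i})]^\mu+(2^\mu-1)^{m+1}\sum_{i=m+1}^{N-2}[E^a_\alpha(\rho_{AB_i})]^\mu+(2^\mu-1)^m[E^a_\alpha(\rho_{AB_{N-1}})]^\mu,$$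 with the convention $0^0=1$. Moreover, the right-hand side is at most $\sum_{i=1}^{N-1}[E^a_\alpha(\rho_{AB_i})]^\mu$, so this bound is at least as tight as the unweighted polygamy bound. -/

import Mathlib

noncomputable section

open scoped BigOperators

namespace WPolygamy

/-- The rank one operator `|ψ⟩⟨ψ|`. -/
def pureDensity {Z : Type*} (ψ : Z → ℂ) : Matrix Z Z ℂ :=
  Matrix.vecMulVec ψ (star ψ)

/-- The reduced density matrix `ρ_X = Tr_Y |ψ⟩⟨ψ|` of a vector `ψ ∈ ℂ^X ⊗ ℂ^Y`. -/
def marginal {X Y : Type*} [Fintype Y] (ψ : X × Y → ℂ) : Matrix X X ℂ :=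
  Matrix.of fun x x' => ∑ y, ψ (x, y) * star (ψ (x', y))

theorem marginal_isHermitian {X Y : Type*} [Fintype Y] (ψ : X × Y → ℂ) :
    (marginal ψ).IsHermitian := by
  ext x x'
  simp [marginal, Matrix.conjTranspose_apply, mul_comm]

/-- The Rényi-`α` entropy (logarithms in base 2) of a density matrix, through its eigenvalues:
`(1 - α)⁻¹ log₂ ∑ λᵢ^α` for `α ≠ 1`, and its limit, the von Neumann entropy
`-∑ λᵢ log₂ λᵢ`, for `α = 1`. (For `α > 0`, zero eigenvalues contribute nothing.) -/
def renyiEntropy {X : Type*} [Fintype X] [DecidableEq X] (α : ℝ) {ρ : Matrix X X ℂ}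
    (hρ : ρ.IsHermitian) : ℝ :=
  if α = 1 then -∑ x, hρ.eigenvalues x * Real.logb 2 (hρ.eigenvalues x)
  else 1 / (1 - α) * Real.logb 2 (∑ x, hρ.eigenvalues x ^ α)

/-- The Rényi-`α` entanglement of a pure state of `X|Y`. -/
def pureRenyiEntanglement {X Y : Type*} [Fintype X] [DecidableEq X] [Fintype Y]
    (α : ℝ) (ψ : X × Y → ℂ) : ℝ :=
  renyiEntropy α (marginal_isHermitian ψ)

/-- The concurrence `√(2 (1 - Tr ρ_X²))` of a pure state of `X|Y`. -/
def pureConcurrence {X Y : Type*} [Fintype X] [Fintype Y] (ψ : X × Y → ℂ) : ℝ :=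
  Real.sqrt (2 * (1 - (Matrix.trace (marginal ψ * marginal ψ)).re))

/-- `ρ = ∑ᵢ pᵢ |ψᵢ⟩⟨ψᵢ|` is a (finite) pure state decomposition: the `pᵢ` form a probability
vector and the `ψᵢ` are unit vectors. -/
structure IsPureDecomposition {Z : Type*} [Fintype Z] (ρ : Matrix Z Z ℂ) {k : ℕ}
    (p : Fin k → ℝ) (ψ : Fin k → Z → ℂ) : Prop where
  nonneg : ∀ i, 0 ≤ p i
  sum_eq_one : ∑ i, p i = 1
  norm_eq_one : ∀ i, ∑ z, ‖ψ i z‖ ^ 2 = 1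
  eq_sum : ρ = ∑ i, (p i : ℂ) • pureDensity (ψ i)

/-- The concurrence of a mixed state of `X|Y`: the minimal average concurrence over all pure
state decompositions. -/
def concurrence {X Y : Type*} [Fintype X] [Fintype Y] (ρ : Matrix (X × Y) (X × Y) ℂ) : ℝ :=
  sInf {c : ℝ | ∃ (k : ℕ) (p : Fin k → ℝ) (ψ : Fin k → X × Y → ℂ),
    IsPureDecomposition ρ p ψ ∧ c = ∑ i, p i * pureConcurrence (ψ i)}

/-- The Rényi-`α` entanglement of assistance of a mixed state of `X|Y`: the maximal average
Rényi-`α` entanglement over all pure state decompositions. -/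
def renyiAssistance {X Y : Type*} [Fintype X] [DecidableEq X] [Fintype Y] (α : ℝ)
    (ρ : Matrix (X × Y) (X × Y) ℂ) : ℝ :=
  sSup {e : ℝ | ∃ (k : ℕ) (p : Fin k → ℝ) (ψ : Fin k → X × Y → ℂ),
    IsPureDecomposition ρ p ψ ∧ e = ∑ i, p i * pureRenyiEntanglement α (ψ i)}

/-- Joins a configuration of the qubits in `S` and one of the qubits outside `S`. -/
def glue {ι : Type*} [DecidableEq ι] (S : Finset ι) (y : S → Fin 2) (z : {i // i ∉ S} → Fin 2) :
    ι → Fin 2 :=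
  fun i => if h : i ∈ S then y ⟨i, h⟩ else z ⟨i, h⟩

/-- For a state `ρ` of a qubit `A` and qubits `B_i`, `i ∈ ι`, the reduced state of `A` and the
`B_i` with `i ∈ S`, as a state of the bipartite system `A | (B_i)_{i ∈ S}`: the partial trace
over all `B_i` with `i ∉ S`. -/
def reduceTo {ι : Type*} [Fintype ι] [DecidableEq ι] (S : Finset ι)
    (ρ : Matrix (Fin 2 × (ι → Fin 2)) (Fin 2 × (ι → Fin 2)) ℂ) :
    Matrix (Fin 2 × (S → Fin 2)) (Fin 2 × (S → Fin 2)) ℂ :=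
  Matrix.of fun u v =>
    ∑ z : {i // i ∉ S} → Fin 2, ρ (u.1, glue S u.2 z) (v.1, glue S v.2 z)

/-- The generalized W-class vector `a|10⋯0⟩ + ∑ᵢ bᵢ|0 0⋯1⋯0⟩` of the qubit `A` (first factor)
and the qubits `B_i`, `i ∈ ι`; the `1` of the `i`-th summand of the sum is at `B_i`. -/
def wState {ι : Type*} [Fintype ι] [DecidableEq ι] (a : ℂ) (b : ι → ℂ) :
    Fin 2 × (ι → Fin 2) → ℂ :=
  a • Pi.single (1, 0) 1 + ∑ i, b i • Pi.single (0, Pi.single i 1) 1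

/-- The density matrix of the W-class vector. -/
def wDensity {ι : Type*} [Fintype ι] [DecidableEq ι] (a : ℂ) (b : ι → ℂ) :
    Matrix (Fin 2 × (ι → Fin 2)) (Fin 2 × (ι → Fin 2)) ℂ :=
  pureDensity (wState a b)

end WPolygamy

end

/-! Tracing qubits out of a W-class state leaves `|w⟩⟨w| + q|0⋯0⟩⟨0⋯0|`, where `w` is the W-class
vector of the surviving coefficients (`reduceTo_wDensity`). Everything is then governed by two
numbers: `A = |a|²` and `s = ∑ |b_i|²` over the surviving `B_i`.

On the `A` qubit, members of any decomposition are parallel to `w` away from the vacuum, so all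
decompositions have the same average concurrence `2|a|√s` (`concurrence_wMixed`). The concurrence
hypotheses therefore compare the sums `s`.

For the entropy, let `h` be the binary Rényi entropy and `W(A, s) = (A + s) h(A / (A + s))`, which
is `renyiWeight`. Splitting off the vacuum shows that the assistance of a reduced state is at least
`W(A, s)` (`renyiWeight_le_renyiAssistance`). For the full pure state `W` is also an upper bound
(`renyiAssistance_wDensity_le`). No upper bound is needed for the terms on the right of the theorem.

For `0 < α ≤ 2`, a range containing the given interval, `h` is concave. Its homogeneous extension
`W` is then superadditive, and this makes it monotone and subadditive in `s` (`renyiWeight_mono`,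
`renyiWeight_subadditive`). The weights of the tails `B_k, …, B_{N-1}` thus satisfy the additive
polygamy bound and have the order of the concurrences. The inequality `(x + y)^μ ≤ x^μ + (2^μ - 1)
y^μ` for `0 ≤ y ≤ x` is applied once per qubit: the tail is the smaller part up to `m`, the single
qubit afterwards. -/

noncomputable section

namespace WPolygamy

/-! ### Concavity of the binary Rényi entropy. -/

/-- The Rényi-`α` entropy (base 2) of the probability vector `(p, 1 - p)`. -/
def binaryRenyi (α p : ℝ) : ℝ :=
  if α = 1 then -(p * Real.logb 2 p + (1 - p) * Real.logb 2 (1 - p))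
  else 1 / (1 - α) * Real.logb 2 (p ^ α + (1 - p) ^ α)

theorem binaryRenyi_symm (α p : ℝ) : binaryRenyi α (1 - p) = binaryRenyi α p := by
  unfold binaryRenyi
  rw [sub_sub_cancel]
  split_ifs
  · ring
  · rw [add_comm]

theorem binaryRenyi_zero {α : ℝ} (hα : 0 < α) : binaryRenyi α 0 = 0 := by
  unfold binaryRenyi
  split_ifs <;> simp [Real.zero_rpow hα.ne']

theorem binaryRenyi_one {α : ℝ} (hα : 0 < α) : binaryRenyi α 1 = 0 := by
  have := binaryRenyi_symm α 1
  rw [sub_self, binaryRenyi_zero hα] at this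
  exact this.symm

theorem rpow_add_rpow_one_sub_pos {p : ℝ} (α : ℝ) (hp : p ∈ Set.Icc (0 : ℝ) 1) :
    0 < p ^ α + (1 - p) ^ α := by
  have h1 := Real.rpow_nonneg hp.1 α
  have h2 := Real.rpow_nonneg (sub_nonneg.2 hp.2) α
  rcases hp.1.eq_or_lt with h | h
  · subst h
    simp only [sub_zero, Real.one_rpow] at *
    linarith
  · linarith [Real.rpow_pos_of_pos h α]

/-- For `α ≤ 1` both powers are concave, and the logarithm is increasing and concave. -/
theorem concaveOn_log_rpow_add_rpow {α : ℝ} (h0 : 0 ≤ α) (h1 : α ≤ 1) :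
    ConcaveOn ℝ (Set.Icc 0 1) fun p : ℝ => Real.log (p ^ α + (1 - p) ^ α) := by
  refine ⟨convex_Icc 0 1, fun x hx y hy s t hs ht hst => ?_⟩
  have hxF := rpow_add_rpow_one_sub_pos α hx
  have hyF := rpow_add_rpow_one_sub_pos α hy
  have c1 := (Real.concaveOn_rpow h0 h1).2 (Set.mem_Ici.2 hx.1) (Set.mem_Ici.2 hy.1) hs ht hst
  have c2 := (Real.concaveOn_rpow h0 h1).2 (Set.mem_Ici.2 (sub_nonneg.2 hx.2))
    (Set.mem_Ici.2 (sub_nonneg.2 hy.2)) hs ht hst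
  have c3 := strictConcaveOn_log_Ioi.concaveOn.2 (Set.mem_Ioi.2 hxF) (Set.mem_Ioi.2 hyF) hs ht hst
  have hpos := (convex_Ioi (0 : ℝ)) (Set.mem_Ioi.2 hxF) (Set.mem_Ioi.2 hyF) hs ht hst
  have e : 1 - (s * x + t * y) = s * (1 - x) + t * (1 - y) := by
    linear_combination (-1 : ℝ) * hst
  simp only [smul_eq_mul, Set.mem_Ioi] at *
  refine c3.trans (Real.log_le_log hpos ?_)
  rw [e]
  linarith

/-- Bernoulli's inequality for `r` and `r⁻¹`, `r = p / q`, with denominators cleared. -/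
theorem rpow_two_mul_add_le {p q β : ℝ} (hp : 0 < p) (hq : 0 < q) (h0 : 0 ≤ β) (h1 : β ≤ 1) :
    p ^ β * p ^ β + q ^ β * q ^ β ≤
      p ^ β * q ^ β * (β * (p / q + q / p) + 2 * (1 + β)) := by
  have key : ∀ r : ℝ, 0 < r → r ^ β ≤ 1 + β * (r - 1) := fun r hr => by
    have := rpow_one_add_le_one_add_mul_self (s := r - 1) (by linarith) h0 h1
    simpa using this
  have e1 := key (p / q) (by positivity)
  have e2 := key (q / p) (by positivity)
  rw [Real.div_rpow hp.le hq.le] at e1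
  rw [Real.div_rpow hq.le hp.le] at e2
  have hP := Real.rpow_pos_of_pos hp β
  have hQ := Real.rpow_pos_of_pos hq β
  calc p ^ β * p ^ β + q ^ β * q ^ β
      = p ^ β * q ^ β * (p ^ β / q ^ β + q ^ β / p ^ β) := by field_simp
    _ ≤ _ := by
      apply mul_le_mul_of_nonneg_left _ (by positivity)
      linarith

/-- With `F = p^α + (1 - p)^α`, the second derivative of `log F` has the sign of `F'' F - F'²`,
which `rpow_two_mul_add_le` with `β = α - 1` shows to be nonnegative. The factor `1 / (1 - α)` is
negative here, so convexity of the logarithm gives concavity of the entropy. -/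
theorem convexOn_log_rpow_add_rpow {α : ℝ} (h1 : 1 < α) (h2 : α ≤ 2) :
    ConvexOn ℝ (Set.Icc 0 1) fun p : ℝ => Real.log (p ^ α + (1 - p) ^ α) := by
  have hF' : ∀ x ∈ Set.Ioo (0 : ℝ) 1, HasDerivAt (fun p : ℝ => p ^ α + (1 - p) ^ α)
      (α * x ^ (α - 1) - α * (1 - x) ^ (α - 1)) x := fun x hx => by
    have a1 := Real.hasDerivAt_rpow_const (x := x) (p := α) (Or.inl hx.1.ne')
    have a2 := ((hasDerivAt_id x).const_sub 1).rpow_const (p := α)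
      (Or.inl (sub_pos.2 hx.2).ne')
    refine (a1.add a2).congr_deriv ?_
    simp only [id]
    ring
  have hF'' : ∀ x ∈ Set.Ioo (0 : ℝ) 1,
      HasDerivAt (fun p : ℝ => α * p ^ (α - 1) - α * (1 - p) ^ (α - 1))
      (α * (α - 1) * (x ^ (α - 1) / x + (1 - x) ^ (α - 1) / (1 - x))) x := fun x hx => by
    have a1 := Real.hasDerivAt_rpow_const (x := x) (p := α - 1) (Or.inl hx.1.ne')
    have a2 := ((hasDerivAt_id x).const_sub 1).rpow_const (p := α - 1)
      (Or.inl (sub_pos.2 hx.2).ne')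
    refine ((a1.const_mul α).sub (a2.const_mul α)).congr_deriv ?_
    rw [Real.rpow_sub_one hx.1.ne' (α - 1), id, Real.rpow_sub_one (sub_pos.2 hx.2).ne' (α - 1)]
    ring
  have hFpos : ∀ x ∈ Set.Ioo (0 : ℝ) 1, 0 < x ^ α + (1 - x) ^ α := fun x hx =>
    rpow_add_rpow_one_sub_pos α ⟨hx.1.le, hx.2.le⟩
  refine convexOn_of_hasDerivWithinAt2_nonneg (convex_Icc 0 1) (f' := fun x =>
      (α * x ^ (α - 1) - α * (1 - x) ^ (α - 1)) / (x ^ α + (1 - x) ^ α))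
    (f'' := fun x => ((α * (α - 1) * (x ^ (α - 1) / x + (1 - x) ^ (α - 1) / (1 - x))) *
      (x ^ α + (1 - x) ^ α) - (α * x ^ (α - 1) - α * (1 - x) ^ (α - 1)) *
      (α * x ^ (α - 1) - α * (1 - x) ^ (α - 1))) / (x ^ α + (1 - x) ^ α) ^ 2) ?_ ?_ ?_ ?_
  · refine ContinuousOn.log ?_ fun x hx => (rpow_add_rpow_one_sub_pos α hx).ne'
    refine Continuous.continuousOn ?_
    exact (Real.continuous_rpow_const (by linarith)).add
      ((Real.continuous_rpow_const (by linarith)).comp (continuous_const.sub continuous_id))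
  · intro x hx
    rw [interior_Icc] at hx ⊢
    exact ((hF' x hx).log (hFpos x hx).ne').hasDerivWithinAt
  · intro x hx
    rw [interior_Icc] at hx ⊢
    exact ((hF'' x hx).div (hF' x hx) (hFpos x hx).ne').hasDerivWithinAt
  · intro x hx
    rw [interior_Icc] at hx
    refine div_nonneg ?_ (sq_nonneg _)
    have hx0 := hx.1
    have hx1 := sub_pos.2 hx.2
    have key := rpow_two_mul_add_le (β := α - 1) hx0 hx1 (by linarith) (by linarith)
    have ex : x ^ α = x ^ (α - 1) * x := by
      rw [Real.rpow_sub_one hx0.ne']; field_simp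
    have ey : (1 - x) ^ α = (1 - x) ^ (α - 1) * (1 - x) := by
      rw [Real.rpow_sub_one hx1.ne']; field_simp
    rw [ex, ey]
    generalize x ^ (α - 1) = P at *
    generalize (1 - x) ^ (α - 1) = Q at *
    generalize 1 - x = y at *
    -- The numerator `F'' F - F'²` is `α` times the gap in `rpow_two_mul_add_le`.
    have e : α * (α - 1) * (P / x + Q / y) * (P * x + Q * y) -
        (α * P - α * Q) * (α * P - α * Q) =
        α * (P * Q * ((α - 1) * (x / y + y / x) + 2 * (1 + (α - 1))) - (P * P + Q * Q)) := by
      field_simp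
      ring
    rw [e]
    exact mul_nonneg (by linarith) (by linarith)

theorem binaryRenyi_concaveOn {α : ℝ} (h0 : 0 < α) (h2 : α ≤ 2) :
    ConcaveOn ℝ (Set.Icc 0 1) (binaryRenyi α) := by
  have hl : 0 < Real.log 2 := Real.log_pos one_lt_two
  rcases lt_trichotomy α 1 with h | h | h
  · have := (concaveOn_log_rpow_add_rpow h0.le h.le).smul
      (c := 1 / (1 - α) / Real.log 2) (by have := sub_pos.2 h; positivity)
    refine this.congr fun p _ => ?_
    simp only [binaryRenyi, if_neg h.ne, Real.logb, smul_eq_mul]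
    ring
  · have := Real.strictConcave_binEntropy.concaveOn.smul
      (c := 1 / Real.log 2) (by positivity)
    refine this.congr fun p _ => ?_
    simp only [binaryRenyi, if_pos h, Real.logb, smul_eq_mul,
      Real.binEntropy_eq_negMulLog_add_negMulLog_one_sub, Real.negMulLog]
    ring
  · have := ((convexOn_log_rpow_add_rpow h h2).smul
      (c := 1 / (α - 1) / Real.log 2) (by have := sub_pos.2 h; positivity)).neg
    refine this.congr fun p _ => ?_
    have e : 1 - α = -(α - 1) := by ring
    simp only [binaryRenyi, if_neg h.ne', Real.logb, smul_eq_mul, Pi.neg_apply, e,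
      one_div_neg_eq_neg_one_div]
    ring

theorem concaveOn_combination_le {D : Set ℝ} {f : ℝ → ℝ} (hf : ConcaveOn ℝ D f) {x y : ℝ}
    (hx : x ∈ D) (hy : y ∈ D) (s t : ℝ) (hs : 0 ≤ s) (ht : 0 ≤ t) (hst : s + t = 1) :
    s * f x + t * f y ≤ f (s * x + t * y) :=
  hf.2 hx hy hs ht hst

theorem binaryRenyi_nonneg {α p : ℝ} (h0 : 0 < α) (h2 : α ≤ 2) (hp : p ∈ Set.Icc (0 : ℝ) 1) :
    0 ≤ binaryRenyi α p := by
  have := (binaryRenyi_concaveOn h0 h2).2 (Set.left_mem_Icc.2 zero_le_one)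
    (Set.right_mem_Icc.2 zero_le_one) (sub_nonneg.2 hp.2) hp.1 (by ring)
  simpa [binaryRenyi_zero h0, binaryRenyi_one h0] using this

theorem binaryRenyi_le_half {α p : ℝ} (h0 : 0 < α) (h2 : α ≤ 2) (hp : p ∈ Set.Icc (0 : ℝ) 1) :
    binaryRenyi α p ≤ binaryRenyi α (1 / 2) := by
  have := concaveOn_combination_le (binaryRenyi_concaveOn h0 h2) hp
    (y := 1 - p) ⟨by linarith [hp.2], by linarith [hp.1]⟩ (1 / 2) (1 / 2)
    (by norm_num) (by norm_num) (by norm_num)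
  rw [binaryRenyi_symm] at this
  have e : 1 / 2 * p + 1 / 2 * (1 - p) = 1 / 2 := by ring
  rw [e] at this
  linarith

/-! ### The homogeneous weight and its additivity properties. -/

/-- The degree one homogeneous extension of the binary Rényi entropy to unnormalized
spectra `(A, s)`. -/
def renyiWeight (α A s : ℝ) : ℝ := (A + s) * binaryRenyi α (A / (A + s))

theorem div_add_mem_Icc {A s : ℝ} (hA : 0 ≤ A) (hs : 0 ≤ s) :
    A / (A + s) ∈ Set.Icc (0 : ℝ) 1 :=
  ⟨by positivity, div_le_one_of_le₀ (by linarith) (by linarith)⟩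

theorem renyiWeight_nonneg {α A s : ℝ} (h0 : 0 < α) (h2 : α ≤ 2) (hA : 0 ≤ A) (hs : 0 ≤ s) :
    0 ≤ renyiWeight α A s :=
  mul_nonneg (by linarith) (binaryRenyi_nonneg h0 h2 (div_add_mem_Icc hA hs))

theorem renyiWeight_smul (α A s : ℝ) {c : ℝ} :
    renyiWeight α (c * A) (c * s) = c * renyiWeight α A s := by
  rcases eq_or_ne c 0 with rfl | hc
  · simp [renyiWeight]
  · rw [renyiWeight, renyiWeight, ← mul_add, mul_div_mul_left _ _ hc, mul_assoc]

/-- Concavity of `binaryRenyi` with the total masses as weights. Zero mass is treated apart, because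
the ratio is then `0 / 0`. -/
theorem renyiWeight_superadditive {α A s A' s' : ℝ} (h0 : 0 < α) (h2 : α ≤ 2)
    (hA : 0 ≤ A) (hs : 0 ≤ s) (hA' : 0 ≤ A') (hs' : 0 ≤ s') :
    renyiWeight α A s + renyiWeight α A' s' ≤ renyiWeight α (A + A') (s + s') := by
  rcases (add_nonneg hA hs).eq_or_lt with h | h
  · obtain rfl : A = 0 := by linarith
    obtain rfl : s = 0 := by linarith
    simp [renyiWeight]
  rcases (add_nonneg hA' hs').eq_or_lt with h' | h'
  · obtain rfl : A' = 0 := by linarith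
    obtain rfl : s' = 0 := by linarith
    simp [renyiWeight]
  have hw : 0 < A + A' + (s + s') := by linarith
  have := concaveOn_combination_le (binaryRenyi_concaveOn h0 h2)
    (div_add_mem_Icc hA hs) (div_add_mem_Icc hA' hs')
    ((A + s) / (A + A' + (s + s'))) ((A' + s') / (A + A' + (s + s')))
    (by positivity) (by positivity) (by field_simp; ring)
  have e : (A + s) / (A + A' + (s + s')) * (A / (A + s)) +
      (A' + s') / (A + A' + (s + s')) * (A' / (A' + s')) = (A + A') / (A + A' + (s + s')) := by
    field_simp
  rw [e] at this
  have := mul_le_mul_of_nonneg_left this hw.le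
  refine le_trans (le_of_eq ?_) this
  simp only [renyiWeight]
  field_simp

theorem renyiWeight_mono {α A s s' : ℝ} (h0 : 0 < α) (h2 : α ≤ 2)
    (hA : 0 ≤ A) (hs : 0 ≤ s) (h : s ≤ s') : renyiWeight α A s ≤ renyiWeight α A s' := by
  have := renyiWeight_superadditive h0 h2 hA hs le_rfl (sub_nonneg.2 h)
  rw [add_zero, add_sub_cancel] at this
  linarith [renyiWeight_nonneg h0 h2 le_rfl (sub_nonneg.2 h)]

/-- The pair `(A, c s)` is `c (A, s)` plus `((1 - c) A, 0)`, and the second summand has nonnegative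
weight. -/
theorem le_renyiWeight_mul {α A s c : ℝ} (h0 : 0 < α) (h2 : α ≤ 2)
    (hA : 0 ≤ A) (hs : 0 ≤ s) (hc : c ∈ Set.Icc (0 : ℝ) 1) :
    c * renyiWeight α A s ≤ renyiWeight α A (c * s) := by
  have hc' : 0 ≤ (1 - c) * A := mul_nonneg (sub_nonneg.2 hc.2) hA
  have := renyiWeight_superadditive h0 h2 (mul_nonneg hc.1 hA) (mul_nonneg hc.1 hs) hc' le_rfl
  rw [renyiWeight_smul, add_zero, ← add_mul, add_sub_cancel, one_mul] at this
  linarith [renyiWeight_nonneg h0 h2 hc' le_rfl]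

/-- `le_renyiWeight_mul` is used with the two complementary fractions `s / (s + s')` and `s' / (s +
s')`. -/
theorem renyiWeight_subadditive {α A s s' : ℝ} (h0 : 0 < α) (h2 : α ≤ 2)
    (hA : 0 ≤ A) (hs : 0 ≤ s) (hs' : 0 ≤ s') :
    renyiWeight α A (s + s') ≤ renyiWeight α A s + renyiWeight α A s' := by
  rcases (add_nonneg hs hs').eq_or_lt with h | h
  · obtain rfl : s = 0 := by linarith
    obtain rfl : s' = 0 := by linarith
    simpa using renyiWeight_nonneg h0 h2 hA le_rfl
  have e1 := le_renyiWeight_mul h0 h2 hA h.le (div_add_mem_Icc hs hs')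
  have hm := div_add_mem_Icc hs' hs
  rw [add_comm s' s] at hm
  have e2 := le_renyiWeight_mul h0 h2 hA h.le hm
  rw [div_mul_cancel₀ _ h.ne'] at e1 e2
  have : s / (s + s') + s' / (s + s') = 1 := by field_simp
  calc _ = (s / (s + s') + s' / (s + s')) * renyiWeight α A (s + s') := by rw [this, one_mul]
    _ ≤ _ := by rw [add_mul]; exact add_le_add e1 e2

/-! ### The power inequality and its iteration. -/

/-- The points `x` and `2y` lie between `y` and `x + y` and have the same sum, so concavity of `t ↦
t^μ` gives `(x + y)^μ + y^μ ≤ x^μ + (2y)^μ`. -/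
theorem rpow_add_le_of_le {x y μ : ℝ} (hy : 0 ≤ y) (hyx : y ≤ x) (h0 : 0 ≤ μ) (h1 : μ ≤ 1) :
    (x + y) ^ μ ≤ x ^ μ + ((2 : ℝ) ^ μ - 1) * y ^ μ := by
  rcases (hy.trans hyx).eq_or_lt with h | h
  · obtain rfl : x = 0 := h.symm
    obtain rfl : y = 0 := le_antisymm hyx hy
    have := Real.one_le_rpow one_le_two h0
    have h' := mul_nonneg (sub_nonneg.2 this) (Real.rpow_nonneg (le_refl (0 : ℝ)) μ)
    rw [add_zero]
    linarith
  have hc := Real.concaveOn_rpow h0 h1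
  have hs : y / x ≤ 1 := (div_le_one h).2 hyx
  have hmem : (x + y) ∈ Set.Ici (0 : ℝ) := Set.mem_Ici.2 (by linarith)
  have c1 := concaveOn_combination_le hc hmem (Set.mem_Ici.2 hy) (1 - y / x) (y / x)
    (sub_nonneg.2 hs) (by positivity) (by ring)
  have c2 := concaveOn_combination_le hc hmem (Set.mem_Ici.2 hy) (y / x) (1 - y / x)
    (by positivity) (sub_nonneg.2 hs) (by ring)
  have e1 : (1 - y / x) * (x + y) + y / x * y = x := by field_simp; ring
  have e2 : y / x * (x + y) + (1 - y / x) * y = 2 * y := by field_simp; ring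
  rw [e1] at c1
  rw [e2, Real.mul_rpow zero_le_two hy] at c2
  linarith

/-- Peeling off the larger term repeatedly. -/
theorem rpow_le_sum_range_of_ge {μ : ℝ} (h0 : 0 ≤ μ) (h1 : μ ≤ 1) {x T : ℕ → ℝ}
    (hT : ∀ k, 0 ≤ T k) (n : ℕ) (hadd : ∀ k < n, T k ≤ x k + T (k + 1))
    (hle : ∀ k < n, T (k + 1) ≤ x k) :
    T 0 ^ μ ≤ ∑ k ∈ Finset.range n, ((2 : ℝ) ^ μ - 1) ^ k * x k ^ μ +
      ((2 : ℝ) ^ μ - 1) ^ n * T n ^ μ := by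
  have hκ : (0 : ℝ) ≤ 2 ^ μ - 1 := sub_nonneg.2 (Real.one_le_rpow one_le_two h0)
  induction n with
  | zero => simp
  | succ n ih =>
    refine (ih (fun k hk => hadd k (by omega)) fun k hk => hle k (by omega)).trans ?_
    have s1 := Real.rpow_le_rpow (hT n) (hadd n (by omega)) h0
    have s2 := rpow_add_le_of_le (hT (n + 1)) (hle n (by omega)) h0 h1
    have s3 := mul_le_mul_of_nonneg_left (s1.trans s2) (pow_nonneg hκ n)
    rw [Finset.sum_range_succ, pow_succ]
    linarith

/-- Peeling off the smaller term repeatedly. -/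
theorem rpow_le_sum_Ico_of_le {μ : ℝ} (h0 : 0 ≤ μ) (h1 : μ ≤ 1) {x T : ℕ → ℝ}
    (hT : ∀ k, 0 ≤ T k) (hx : ∀ k, 0 ≤ x k) {m n : ℕ} (hmn : m ≤ n)
    (hadd : ∀ k, m ≤ k → k < n → T k ≤ x k + T (k + 1))
    (hle : ∀ k, m ≤ k → k < n → x k ≤ T (k + 1)) :
    T m ^ μ ≤ ((2 : ℝ) ^ μ - 1) * ∑ k ∈ Finset.Ico m n, x k ^ μ + T n ^ μ := by
  induction n, hmn using Nat.le_induction with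
  | base => simp
  | succ n hmn ih =>
    refine (ih (fun k hk hk' => hadd k hk (by omega)) fun k hk hk' => hle k hk (by omega)).trans ?_
    have s1 := Real.rpow_le_rpow (hT n) (hadd n hmn (by omega)) h0
    -- The roles are exchanged: the tail is now the larger part and keeps coefficient one.
    rw [add_comm] at s1
    have s2 := rpow_add_le_of_le (hx n) (hle n hmn (by omega)) h0 h1
    rw [Finset.sum_Ico_succ_top hmn]
    linarith

end WPolygamy

end

noncomputable section

namespace WPolygamy

/-! ### Reduced states of W-class vectors. -/

section WState

variable {ι : Type*} [DecidableEq ι]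

theorem single_one_injective : Function.Injective fun i : ι => (Pi.single i 1 : ι → Fin 2) := by
  intro i j h
  by_contra hne
  have := congrFun h i
  simp [hne] at this

theorem zero_ne_single_one (i : ι) : (0 : ι → Fin 2) ≠ Pi.single i 1 := by
  intro h
  have := congrFun h i
  simp at this

theorem glue_eq_zero_iff (S : Finset ι) (y : S → Fin 2) (z : {i // i ∉ S} → Fin 2) :
    glue S y z = 0 ↔ y = 0 ∧ z = 0 := by
  constructor
  · intro h
    refine ⟨funext fun i => ?_, funext fun i => ?_⟩
    · simpa [glue, i.2] using congrFun h i
    · simpa [glue, i.2] using congrFun h i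
  · rintro ⟨rfl, rfl⟩
    funext i
    simp [glue]

theorem glue_eq_single_mem_iff (S : Finset ι) (y : S → Fin 2) (z : {i // i ∉ S} → Fin 2)
    (i : S) : glue S y z = Pi.single (i : ι) 1 ↔ y = Pi.single i 1 ∧ z = 0 := by
  constructor
  · intro h
    refine ⟨funext fun j => ?_, funext fun j => ?_⟩
    · have := congrFun h j
      simpa [glue, j.2, Pi.single_apply] using this
    · have := congrFun h j
      have hne : (j : ι) ≠ i := fun e => j.2 (e ▸ i.2)
      simpa [glue, j.2, Pi.single_apply, hne] using this
  · rintro ⟨rfl, rfl⟩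
    funext j
    by_cases hj : j ∈ S
    · simp [glue, hj, Pi.single_apply, Subtype.ext_iff]
    · have hne : j ≠ i := fun e => hj (e ▸ i.2)
      simp [glue, hj, hne]

theorem glue_eq_single_notMem_iff (S : Finset ι) (y : S → Fin 2) (z : {i // i ∉ S} → Fin 2)
    (i : {i // i ∉ S}) : glue S y z = Pi.single (i : ι) 1 ↔ y = 0 ∧ z = Pi.single i 1 := by
  constructor
  · intro h
    refine ⟨funext fun j => ?_, funext fun j => ?_⟩
    · have := congrFun h j
      have hne : (j : ι) ≠ i := fun e => i.2 (e ▸ j.2)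
      simpa [glue, j.2, Pi.single_apply, hne] using this
    · have := congrFun h j
      simpa [glue, j.2, Pi.single_apply, Subtype.ext_iff] using this
  · rintro ⟨rfl, rfl⟩
    funext j
    by_cases hj : j ∈ S
    · have hne : j ≠ i := fun e => i.2 (e ▸ hj)
      simp [glue, hj, hne]
    · simp [glue, hj, Pi.single_apply, Subtype.ext_iff]

variable [Fintype ι]

theorem wState_one (a : ℂ) (b : ι → ℂ) (y : ι → Fin 2) :
    wState a b (1, y) = if y = 0 then a else 0 := by
  simp [wState, Pi.single_apply]

theorem wState_zero (a : ℂ) (b : ι → ℂ) (y : ι → Fin 2) :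
    wState a b (0, y) = ∑ i, if y = Pi.single i 1 then b i else 0 := by
  simp [wState, Pi.single_apply, Finset.sum_apply]

theorem wState_zero_single (a : ℂ) (b : ι → ℂ) (i : ι) :
    wState a b (0, Pi.single i 1) = b i := by
  rw [wState_zero, Finset.sum_eq_single i]
  · simp
  · intro j _ hj
    exact if_neg fun h => hj (single_one_injective h).symm
  · simp

theorem wState_zero_eq_zero (a : ℂ) (b : ι → ℂ) {y : ι → Fin 2}
    (hy : ∀ i, y ≠ Pi.single i 1) : wState a b (0, y) = 0 := by
  rw [wState_zero]
  exact Finset.sum_eq_zero fun i _ => if_neg (hy i)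

theorem wState_zero_zero (a : ℂ) (b : ι → ℂ) : wState a b (0, 0) = 0 :=
  wState_zero_eq_zero a b zero_ne_single_one

theorem sum_norm_wState_zero (a : ℂ) (b : ι → ℂ) :
    ∑ y, ‖wState a b (0, y)‖ ^ 2 = ∑ i, ‖b i‖ ^ 2 := by
  have h : ∀ y : ι → Fin 2, ‖wState a b (0, y)‖ ^ 2 =
      ∑ i, if y = Pi.single i 1 then ‖b i‖ ^ 2 else 0 := by
    intro y
    by_cases hy : ∃ i, y = Pi.single i 1
    · obtain ⟨i, rfl⟩ := hy
      rw [wState_zero_single, Finset.sum_eq_single i]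
      · simp
      · intro j _ hj
        exact if_neg fun h => hj (single_one_injective h).symm
      · simp
    · push Not at hy
      rw [wState_zero_eq_zero a b hy, Finset.sum_eq_zero fun i _ => if_neg (hy i)]
      simp
  simp_rw [h]
  rw [Finset.sum_comm]
  simp

theorem sum_norm_wState (a : ℂ) (b : ι → ℂ) :
    ∑ z, ‖wState a b z‖ ^ 2 = ‖a‖ ^ 2 + ∑ i, ‖b i‖ ^ 2 := by
  rw [Fintype.sum_prod_type, Fin.sum_univ_two, sum_norm_wState_zero, add_comm]
  congr 1
  rw [Finset.sum_eq_single 0]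
  · simp [wState_one]
  · intro y _ hy
    simp [wState_one, hy]
  · simp

/-- A W-class vector mixed with the weight `q` of the vacuum `|0⋯0⟩`. -/
def wMixed (a : ℂ) (b : ι → ℂ) (q : ℝ) : Matrix (Fin 2 × (ι → Fin 2)) (Fin 2 × (ι → Fin 2)) ℂ :=
  wDensity a b + (q : ℂ) • pureDensity (Pi.single (0, 0) 1)

theorem wMixed_zero (a : ℂ) (b : ι → ℂ) : wMixed a b 0 = wDensity a b := by
  simp [wMixed]

theorem wMixed_apply_of_ne (a : ℂ) (b : ι → ℂ) (q : ℝ) {z z' : Fin 2 × (ι → Fin 2)}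
    (h : z ≠ (0, 0) ∨ z' ≠ (0, 0)) :
    wMixed a b q z z' = wState a b z * star (wState a b z') := by
  rcases h with h | h <;>
  simp [wMixed, wDensity, pureDensity, Matrix.vecMulVec_apply, h]

/-- The single excitation sits either in `A` and `S`, with the rest empty, or outside `S`, with `A`
and `S` empty. -/
theorem wState_glue (S : Finset ι) (a : ℂ) (b : ι → ℂ) (u : Fin 2 × (S → Fin 2))
    (z : {i // i ∉ S} → Fin 2) :
    wState a b (u.1, glue S u.2 z) =
      wState a (fun i : S => b i) u * (if z = 0 then 1 else 0) +
        (if u = (0, 0) then 1 else 0) * wState 0 (fun i : {i // i ∉ S} => b i) (0, z) := by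
  obtain ⟨x, y⟩ := u
  fin_cases x
  · simp only [Fin.zero_eta, wState_zero]
    rw [← Fintype.sum_subtype_add_sum_subtype (fun i => i ∈ S)]
    simp only [Prod.mk.injEq, true_and]
    congr 1
    · rw [Finset.sum_mul]
      refine Finset.sum_congr (by ext; simp) fun i _ => ?_
      rw [if_congr (glue_eq_single_mem_iff S y z i) rfl rfl]
      by_cases h1 : y = Pi.single i 1 <;> by_cases h2 : z = 0 <;> simp [h1, h2]
    · rw [Finset.mul_sum]
      refine Finset.sum_congr rfl fun i _ => ?_
      rw [if_congr (glue_eq_single_notMem_iff S y z i) rfl rfl]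
      by_cases h1 : y = 0 <;> by_cases h2 : z = Pi.single i 1 <;> simp [h1, h2]
  · simp only [Fin.mk_one, wState_one, Prod.mk.injEq, one_ne_zero, false_and, if_false, zero_mul,
      add_zero]
    rw [if_congr (glue_eq_zero_iff S y z) rfl rfl]
    by_cases h1 : y = 0 <;> by_cases h2 : z = 0 <;> simp [h1, h2]

/-- The two parts of `wState_glue` live on disjoint sets of traced configurations `z`, so the
partial trace has no cross terms. The part outside `S` contributes only vacuum. -/
theorem reduceTo_wDensity (S : Finset ι) (a : ℂ) (b : ι → ℂ) :
    reduceTo S (wDensity a b) =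
      wMixed a (fun i : S => b i) (∑ i : {i // i ∉ S}, ‖b i‖ ^ 2) := by
  ext u v
  simp only [reduceTo, Matrix.of_apply, wDensity, pureDensity, Matrix.vecMulVec_apply,
    Pi.star_apply, wState_glue, wMixed, Matrix.add_apply, Matrix.smul_apply, smul_eq_mul]
  rw [← sum_norm_wState_zero 0 (fun i : {i // i ∉ S} => b i)]
  set c := wState (0 : ℂ) (fun i : {i // i ∉ S} => b i)
  have hc0 : c (0, 0) = 0 := wState_zero_zero _ _
  set w := wState a (fun i : S => b i)
  have h : ∀ z, (w u * (if z = 0 then 1 else 0) + (if u = (0, 0) then 1 else 0) * c (0, z)) *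
      star (w v * (if z = 0 then 1 else 0) + (if v = (0, 0) then 1 else 0) * c (0, z)) =
      (if z = 0 then w u * star (w v) else 0) +
      ((‖c (0, z)‖ ^ 2 : ℝ) : ℂ) * ((if u = (0, 0) then 1 else 0) *
        if v = (0, 0) then 1 else 0) := by
    intro z
    have hn : ((‖c (0, z)‖ ^ 2 : ℝ) : ℂ) = c (0, z) * star (c (0, z)) := by
      rw [Complex.star_def, Complex.mul_conj, Complex.normSq_eq_norm_sq]
    rw [hn]
    by_cases hz : z = 0
    · simp [hz, hc0]
    · by_cases hu : u = (0, 0) <;> by_cases hv : v = (0, 0) <;> simp [hz, hu, hv]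
  rw [Finset.sum_congr rfl fun z _ => h z, Finset.sum_add_distrib, ← Finset.sum_mul]
  by_cases hu : u = (0, 0) <;> by_cases hv : v = (0, 0) <;> simp [hu, hv]

end WState

/-! ### Constraints on the members of a pure state decomposition. -/

section Decomposition

variable {Z : Type*} [Fintype Z] {ρ : Matrix Z Z ℂ} {k : ℕ} {p : Fin k → ℝ} {ψ : Fin k → Z → ℂ}

theorem IsPureDecomposition.apply_eq (h : IsPureDecomposition ρ p ψ) (z z' : Z) :
    ρ z z' = ∑ i, (p i : ℂ) * (ψ i z * star (ψ i z')) := by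
  conv_lhs => rw [h.eq_sum]
  simp [Matrix.sum_apply, pureDensity, Matrix.vecMulVec_apply]

theorem IsPureDecomposition.sum_norm_sq (h : IsPureDecomposition ρ p ψ) (z : Z) :
    ∑ i, p i * ‖ψ i z‖ ^ 2 = (ρ z z).re := by
  rw [h.apply_eq, Complex.re_sum]
  refine Finset.sum_congr rfl fun i _ => ?_
  rw [Complex.star_def, Complex.mul_conj, Complex.normSq_eq_norm_sq]
  norm_cast

theorem IsPureDecomposition.eq_zero (h : IsPureDecomposition ρ p ψ) {z : Z} (hz : ρ z z = 0)
    (i : Fin k) (hi : p i ≠ 0) : ψ i z = 0 := by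
  have hs := h.sum_norm_sq z
  rw [hz, Complex.zero_re, Finset.sum_eq_zero_iff_of_nonneg
    fun j _ => mul_nonneg (h.nonneg j) (sq_nonneg _)] at hs
  have := hs i (Finset.mem_univ i)
  simpa [hi] using this

/-- Where `ρ` has the entries of `|w⟩⟨w|`, the members of a decomposition are proportional
to `w`. -/
theorem IsPureDecomposition.mul_eq_mul (h : IsPureDecomposition ρ p ψ) (w : Z → ℂ) {z z' : Z}
    (h1 : ρ z z = w z * star (w z)) (h2 : ρ z z' = w z * star (w z'))
    (h3 : ρ z' z = w z' * star (w z)) (h4 : ρ z' z' = w z' * star (w z'))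
    (i : Fin k) (hi : p i ≠ 0) : w z' * ψ i z = w z * ψ i z' := by
  -- This sum is the quadratic form of `ρ` at a vector supported on `z, z'` and orthogonal to `w`.
  -- Only four entries of `ρ` enter, so a vacuum term elsewhere does no harm.
  have hs : ∑ j, p j * ‖w z' * ψ j z - w z * ψ j z'‖ ^ 2 = 0 := by
    have e : ((∑ j, p j * ‖w z' * ψ j z - w z * ψ j z'‖ ^ 2 : ℝ) : ℂ) =
        w z' * star (w z') * ρ z z - w z' * star (w z) * ρ z z' - w z * star (w z') * ρ z' z +
          w z * star (w z) * ρ z' z' := by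
      rw [h.apply_eq z z, h.apply_eq z z', h.apply_eq z' z, h.apply_eq z' z']
      simp only [Finset.mul_sum, ← Finset.sum_sub_distrib, ← Finset.sum_add_distrib]
      push_cast
      refine Finset.sum_congr rfl fun j _ => ?_
      rw [← Complex.mul_conj', ← Complex.star_def]
      simp only [star_sub, star_mul']
      ring
    have e' : ((∑ j, p j * ‖w z' * ψ j z - w z * ψ j z'‖ ^ 2 : ℝ) : ℂ) = 0 := by
      rw [e, h1, h2, h3, h4]
      ring
    exact_mod_cast e'
  rw [Finset.sum_eq_zero_iff_of_nonneg
    fun j _ => mul_nonneg (h.nonneg j) (sq_nonneg _)] at hs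
  have := hs i (Finset.mem_univ i)
  simpa [hi, sub_eq_zero] using this

end Decomposition

/-! ### Entropy and concurrence from the marginal of one qubit. -/

section Qubit

variable {Y : Type*} [Fintype Y]

theorem marginal_diag (ψ : Fin 2 × Y → ℂ) (x : Fin 2) :
    marginal ψ x x = ((∑ y, ‖ψ (x, y)‖ ^ 2 : ℝ) : ℂ) := by
  simp [marginal, Complex.mul_conj']

theorem marginal_symm (ψ : Fin 2 × Y → ℂ) : marginal ψ 1 0 = star (marginal ψ 0 1) :=
  ((marginal_isHermitian ψ).apply 0 1).symm ▸ by simp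

theorem sum_add_sum_eq_one {ψ : Fin 2 × Y → ℂ} (hψ : ∑ z, ‖ψ z‖ ^ 2 = 1) :
    ∑ y, ‖ψ (0, y)‖ ^ 2 + ∑ y, ‖ψ (1, y)‖ ^ 2 = 1 := by
  rw [← hψ, Fintype.sum_prod_type, Fin.sum_univ_two]

theorem det_marginal (ψ : Fin 2 × Y → ℂ) :
    (marginal ψ).det = (((∑ y, ‖ψ (0, y)‖ ^ 2) * (∑ y, ‖ψ (1, y)‖ ^ 2) -
      ‖marginal ψ 0 1‖ ^ 2 : ℝ) : ℂ) := by
  rw [Matrix.det_fin_two, marginal_symm, marginal_diag, marginal_diag, Complex.star_def,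
    Complex.mul_conj']
  push_cast
  ring

theorem pureConcurrence_eq {ψ : Fin 2 × Y → ℂ} (hψ : ∑ z, ‖ψ z‖ ^ 2 = 1) :
    pureConcurrence ψ = Real.sqrt (4 * ((∑ y, ‖ψ (0, y)‖ ^ 2) * (∑ y, ‖ψ (1, y)‖ ^ 2) -
      ‖marginal ψ 0 1‖ ^ 2)) := by
  have h1 := sum_add_sum_eq_one hψ
  have e : Matrix.trace (marginal ψ * marginal ψ) =
      (((∑ y, ‖ψ (0, y)‖ ^ 2) ^ 2 + (∑ y, ‖ψ (1, y)‖ ^ 2) ^ 2 +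
        2 * ‖marginal ψ 0 1‖ ^ 2 : ℝ) : ℂ) := by
    rw [Matrix.trace_fin_two]
    simp only [Matrix.mul_apply, Fin.sum_univ_two]
    rw [marginal_diag, marginal_diag, marginal_symm]
    push_cast
    rw [← Complex.mul_conj', ← Complex.star_def]
    ring
  rw [pureConcurrence, e, Complex.ofReal_re]
  congr 1
  generalize ∑ y, ‖ψ (0, y)‖ ^ 2 = s at *
  obtain rfl : s = 1 - ∑ y, ‖ψ (1, y)‖ ^ 2 := by linarith
  ring

-- A qubit marginal has trace one, so its spectrum is `(l, 1 - l)`, determined up to order by the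
-- determinant `l (1 - l)`.
open scoped ComplexOrder in
theorem exists_pureRenyiEntanglement_eq (α : ℝ) {ψ : Fin 2 × Y → ℂ}
    (hψ : ∑ z, ‖ψ z‖ ^ 2 = 1) :
    ∃ l ∈ Set.Icc (0 : ℝ) 1, pureRenyiEntanglement α ψ = binaryRenyi α l ∧
      l * (1 - l) = (∑ y, ‖ψ (0, y)‖ ^ 2) * (∑ y, ‖ψ (1, y)‖ ^ 2) - ‖marginal ψ 0 1‖ ^ 2 := by
  have hH := marginal_isHermitian ψ
  have htr : (marginal ψ).trace = ∑ i, ((hH.eigenvalues i : ℝ) : ℂ) := hH.trace_eq_sum_eigenvalues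
  have hdet : (marginal ψ).det = ∏ i, ((hH.eigenvalues i : ℝ) : ℂ) := hH.det_eq_prod_eigenvalues
  rw [Matrix.trace_fin_two, marginal_diag, marginal_diag, Fin.sum_univ_two] at htr
  rw [det_marginal, Fin.prod_univ_two] at hdet
  have htr' : ∑ y, ‖ψ (0, y)‖ ^ 2 + ∑ y, ‖ψ (1, y)‖ ^ 2 = hH.eigenvalues 0 + hH.eigenvalues 1 := by
    exact_mod_cast htr
  have hdet' : (∑ y, ‖ψ (0, y)‖ ^ 2) * (∑ y, ‖ψ (1, y)‖ ^ 2) - ‖marginal ψ 0 1‖ ^ 2 =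
      hH.eigenvalues 0 * hH.eigenvalues 1 := by
    exact_mod_cast hdet
  rw [sum_add_sum_eq_one hψ] at htr'
  have hpos : (marginal ψ).PosSemidef := by
    have : marginal ψ =
        Matrix.of (fun x y => ψ (x, y)) * (Matrix.of fun x y => ψ (x, y)).conjTranspose := by
      ext x x'
      simp [marginal, Matrix.mul_apply]
    rw [this]
    exact Matrix.posSemidef_self_mul_conjTranspose _
  have p0 : 0 ≤ hH.eigenvalues 0 := hpos.eigenvalues_nonneg 0
  have p1 : 0 ≤ hH.eigenvalues 1 := hpos.eigenvalues_nonneg 1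
  have e1 : hH.eigenvalues 1 = 1 - hH.eigenvalues 0 := by linarith
  refine ⟨hH.eigenvalues 0, ⟨p0, by linarith⟩, ?_, ?_⟩
  · simp only [pureRenyiEntanglement, renyiEntropy, binaryRenyi, Fin.sum_univ_two, e1]
  · rw [hdet', e1]

theorem pureRenyiEntanglement_of_marginal_eq_zero (α : ℝ) {ψ : Fin 2 × Y → ℂ}
    (hψ : ∑ z, ‖ψ z‖ ^ 2 = 1) (h0 : marginal ψ 0 1 = 0) :
    pureRenyiEntanglement α ψ = binaryRenyi α (∑ y, ‖ψ (1, y)‖ ^ 2) := by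
  obtain ⟨l, -, h, hl⟩ := exists_pureRenyiEntanglement_eq α hψ
  have h1 := sum_add_sum_eq_one hψ
  generalize ∑ y, ‖ψ (0, y)‖ ^ 2 = s at *
  obtain rfl : s = 1 - ∑ y, ‖ψ (1, y)‖ ^ 2 := by linarith
  generalize ∑ y, ‖ψ (1, y)‖ ^ 2 = t at *
  rw [h0, norm_zero] at hl
  have : (l - t) * (l - (1 - t)) = 0 := by linear_combination -hl
  rcases mul_eq_zero.1 this with h' | h'
  · rw [h, sub_eq_zero.1 h']
  · rw [h, sub_eq_zero.1 h', binaryRenyi_symm]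

/-- Needed because `sSup` of an unbounded set of reals is `0`, and `le_csSup` requires a bound. -/
theorem renyiAssistance_bddAbove {α : ℝ} (h0 : 0 < α) (h2 : α ≤ 2)
    (ρ : Matrix (Fin 2 × Y) (Fin 2 × Y) ℂ) :
    BddAbove {e : ℝ | ∃ (k : ℕ) (p : Fin k → ℝ) (ψ : Fin k → Fin 2 × Y → ℂ),
      IsPureDecomposition ρ p ψ ∧ e = ∑ i, p i * pureRenyiEntanglement α (ψ i)} := by
  refine ⟨binaryRenyi α (1 / 2), ?_⟩
  rintro e ⟨k, p, ψ, h, rfl⟩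
  calc ∑ i, p i * pureRenyiEntanglement α (ψ i)
      ≤ ∑ i, p i * binaryRenyi α (1 / 2) := by
        refine Finset.sum_le_sum fun i _ => mul_le_mul_of_nonneg_left ?_ (h.nonneg i)
        obtain ⟨l, hl, e, -⟩ := exists_pureRenyiEntanglement_eq α (h.norm_eq_one i)
        rw [e]
        exact binaryRenyi_le_half h0 h2 hl
    _ = _ := by rw [← Finset.sum_mul, h.sum_eq_one, one_mul]

end Qubit

end WPolygamy

end

noncomputable section

namespace WPolygamy

/-! ### Concurrence and assistance of mixed W-class states. -/

section WMixed

variable {ι : Type*} [Fintype ι] [DecidableEq ι]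

theorem sum_norm_vacuum : ∑ z : Fin 2 × (ι → Fin 2),
    ‖(Pi.single (0, 0) 1 : Fin 2 × (ι → Fin 2) → ℂ) z‖ ^ 2 = 1 := by
  rw [Finset.sum_eq_single (0, 0)]
  · simp
  · intro z _ hz
    simp [hz]
  · simp

theorem sum_norm_smul_wState (a : ℂ) (b : ι → ℂ) (hw : 0 < ‖a‖ ^ 2 + ∑ i, ‖b i‖ ^ 2) :
    ∑ z, ‖(((√(‖a‖ ^ 2 + ∑ i, ‖b i‖ ^ 2))⁻¹ : ℝ) : ℂ) • wState a b z‖ ^ 2 = 1 := by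
  simp_rw [norm_smul, mul_pow]
  rw [← Finset.mul_sum, sum_norm_wState, Complex.norm_real, Real.norm_eq_abs, sq_abs, inv_pow,
    Real.sq_sqrt hw.le, inv_mul_cancel₀ hw.ne']

/-- The decomposition of a mixed W-class state into the W-class vector and the vacuum. -/
theorem wMixed_isPureDecomposition {a : ℂ} {b : ι → ℂ} {q : ℝ} (hq : 0 ≤ q)
    (h : ‖a‖ ^ 2 + ∑ i, ‖b i‖ ^ 2 + q = 1) (hw : 0 < ‖a‖ ^ 2 + ∑ i, ‖b i‖ ^ 2) :
    IsPureDecomposition (wMixed a b q) ![‖a‖ ^ 2 + ∑ i, ‖b i‖ ^ 2, q]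
      ![fun z => (((√(‖a‖ ^ 2 + ∑ i, ‖b i‖ ^ 2))⁻¹ : ℝ) : ℂ) • wState a b z,
        Pi.single (0, 0) 1] where
  nonneg := by
    rw [Fin.forall_fin_two]
    exact ⟨hw.le, hq⟩
  sum_eq_one := by simpa using h
  norm_eq_one := by
    rw [Fin.forall_fin_two]
    exact ⟨sum_norm_smul_wState a b hw, sum_norm_vacuum⟩
  eq_sum := by
    have hs : (((√(‖a‖ ^ 2 + ∑ i, ‖b i‖ ^ 2))⁻¹ : ℝ) : ℂ) *
        (((√(‖a‖ ^ 2 + ∑ i, ‖b i‖ ^ 2))⁻¹ : ℝ) : ℂ) *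
        ((‖a‖ ^ 2 + ∑ i, ‖b i‖ ^ 2 : ℝ) : ℂ) = 1 := by
      rw [← Complex.ofReal_mul, ← Complex.ofReal_mul, ← mul_inv, Real.mul_self_sqrt hw.le,
        inv_mul_cancel₀ hw.ne', Complex.ofReal_one]
    rw [Fin.sum_univ_two]
    simp only [Matrix.cons_val_zero, Matrix.cons_val_one, wMixed]
    congr 1
    ext u v
    simp only [wDensity, pureDensity, Matrix.vecMulVec_apply, Matrix.smul_apply, Pi.star_apply,
      smul_eq_mul, star_mul', Complex.star_def, Complex.conj_ofReal]
    linear_combination (-(wState a b u * (starRingEnd ℂ) (wState a b v))) * hs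

theorem exists_wMixed_isPureDecomposition {a : ℂ} {b : ι → ℂ} {q : ℝ} (hq : 0 ≤ q)
    (h : ‖a‖ ^ 2 + ∑ i, ‖b i‖ ^ 2 + q = 1) :
    ∃ (k : ℕ) (p : Fin k → ℝ) (ψ : Fin k → Fin 2 × (ι → Fin 2) → ℂ),
      IsPureDecomposition (wMixed a b q) p ψ := by
  have hw : 0 ≤ ‖a‖ ^ 2 + ∑ i, ‖b i‖ ^ 2 := by positivity
  rcases hw.eq_or_lt with hw | hw
  · have hz : wState a b = 0 := by
      have := sum_norm_wState a b
      rw [← hw, Finset.sum_eq_zero_iff_of_nonneg fun z _ => sq_nonneg _] at this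
      funext z
      simpa using this z (Finset.mem_univ z)
    have hq1 : q = 1 := by linarith
    refine ⟨1, fun _ => 1, fun _ => Pi.single (0, 0) 1, fun _ => zero_le_one, by simp,
      fun _ => sum_norm_vacuum, ?_⟩
    ext u v
    simp [wMixed, wDensity, hz, pureDensity, hq1]
  · exact ⟨_, _, _, wMixed_isPureDecomposition hq h hw⟩

theorem wMixed_one_ne {a : ℂ} {b : ι → ℂ} {q : ℝ} {k : ℕ} {p : Fin k → ℝ}
    {ψ : Fin k → Fin 2 × (ι → Fin 2) → ℂ} (hd : IsPureDecomposition (wMixed a b q) p ψ)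
    (i : Fin k) (hi : p i ≠ 0) (y : ι → Fin 2) (hy : y ≠ 0) : ψ i (1, y) = 0 := by
  refine hd.eq_zero ?_ i hi
  rw [wMixed_apply_of_ne _ _ _ (Or.inl (by simp)), wState_one, if_neg hy, zero_mul]

theorem sum_one_of_ne {ψ : Fin 2 × (ι → Fin 2) → ℂ} (h : ∀ y, y ≠ 0 → ψ (1, y) = 0) :
    ∑ y, ‖ψ (1, y)‖ ^ 2 = ‖ψ (1, 0)‖ ^ 2 := by
  refine Finset.sum_eq_single 0 (fun y _ hy => ?_) (by simp)
  simp [h y hy]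

theorem marginal_zero_one_of_ne {ψ : Fin 2 × (ι → Fin 2) → ℂ} (h : ∀ y, y ≠ 0 → ψ (1, y) = 0) :
    marginal ψ 0 1 = ψ (0, 0) * star (ψ (1, 0)) := by
  refine Finset.sum_eq_single 0 (fun y _ hy => ?_) (by simp)
  simp [h y hy]

theorem sum_weight_one {a : ℂ} {b : ι → ℂ} {q : ℝ} {k : ℕ} {p : Fin k → ℝ}
    {ψ : Fin k → Fin 2 × (ι → Fin 2) → ℂ} (hd : IsPureDecomposition (wMixed a b q) p ψ) :
    ∑ i, p i * ‖ψ i (1, 0)‖ ^ 2 = ‖a‖ ^ 2 := by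
  rw [hd.sum_norm_sq, wMixed_apply_of_ne _ _ _ (Or.inl (by simp)), wState_one, if_pos rfl,
    Complex.star_def, Complex.mul_conj']
  norm_cast

/-- The vacuum amplitude `ψ (0, 0)` cancels from the determinant of the marginal, leaving `|ψ (1,
0)|²` times the mass of `ψ (0, y)` with `y ≠ 0`. By proportionality to `w` that mass is itself a
multiple of `|ψ (1, 0)|²`, so the square root is exact. The factor `‖a‖` clears the denominator. -/
theorem pureConcurrence_of_decomposition {a : ℂ} {b : ι → ℂ} {q : ℝ} {k : ℕ} {p : Fin k → ℝ}
    {ψ : Fin k → Fin 2 × (ι → Fin 2) → ℂ} (hd : IsPureDecomposition (wMixed a b q) p ψ)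
    (i : Fin k) (hi : p i ≠ 0) :
    ‖a‖ * pureConcurrence (ψ i) = 2 * √(∑ j, ‖b j‖ ^ 2) * ‖ψ i (1, 0)‖ ^ 2 := by
  have h1 := wMixed_one_ne hd i hi
  have hprop : ∀ y, y ≠ 0 → a * ψ i (0, y) = wState a b (0, y) * ψ i (1, 0) := by
    intro y hy
    have ha : wState a b (1, 0) = a := by rw [wState_one, if_pos rfl]
    have := hd.mul_eq_mul (wState a b) (z := (0, y)) (z' := (1, 0))
      (wMixed_apply_of_ne _ _ _ (Or.inl (by simp [hy])))
      (wMixed_apply_of_ne _ _ _ (Or.inl (by simp [hy])))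
      (wMixed_apply_of_ne _ _ _ (Or.inl (by simp)))
      (wMixed_apply_of_ne _ _ _ (Or.inl (by simp))) i hi
    rwa [ha] at this
  have hsum : ‖a‖ ^ 2 * (∑ y, ‖ψ i (0, y)‖ ^ 2 - ‖ψ i (0, 0)‖ ^ 2) =
      (∑ j, ‖b j‖ ^ 2) * ‖ψ i (1, 0)‖ ^ 2 := by
    rw [← sum_norm_wState_zero a b, ← Finset.add_sum_erase _ _ (Finset.mem_univ 0),
      ← Finset.add_sum_erase _ (fun y => ‖wState a b (0, y)‖ ^ 2) (Finset.mem_univ 0),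
      wState_zero_zero, add_sub_cancel_left, norm_zero, zero_pow two_ne_zero, zero_add,
      Finset.mul_sum, Finset.sum_mul]
    refine Finset.sum_congr rfl fun y hy => ?_
    rw [← mul_pow, ← norm_mul, hprop y (Finset.ne_of_mem_erase hy), norm_mul, mul_pow]
  have hs : 0 ≤ ∑ j, ‖b j‖ ^ 2 := by positivity
  rw [pureConcurrence_eq (hd.norm_eq_one i), sum_one_of_ne h1, marginal_zero_one_of_ne h1,
    norm_mul, norm_star]
  conv_lhs => rw [← Real.sqrt_sq (norm_nonneg a), ← Real.sqrt_mul (sq_nonneg _)]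
  rw [show ‖a‖ ^ 2 * (4 * ((∑ y, ‖ψ i (0, y)‖ ^ 2) * ‖ψ i (1, 0)‖ ^ 2 -
      (‖ψ i (0, 0)‖ * ‖ψ i (1, 0)‖) ^ 2)) =
      (2 * √(∑ j, ‖b j‖ ^ 2) * ‖ψ i (1, 0)‖ ^ 2) ^ 2 by
    simp only [mul_pow, Real.sq_sqrt hs]
    linear_combination 4 * ‖ψ i (1, 0)‖ ^ 2 * hsum]
  exact Real.sqrt_sq (by positivity)

/-- All pure state decompositions of a mixed W-class state have the same average concurrence. -/
theorem sum_pureConcurrence {a : ℂ} {b : ι → ℂ} {q : ℝ} {k : ℕ} {p : Fin k → ℝ}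
    {ψ : Fin k → Fin 2 × (ι → Fin 2) → ℂ} (hd : IsPureDecomposition (wMixed a b q) p ψ) :
    ∑ i, p i * pureConcurrence (ψ i) = 2 * ‖a‖ * √(∑ j, ‖b j‖ ^ 2) := by
  rcases eq_or_ne a 0 with rfl | ha
  · rw [norm_zero, mul_zero, zero_mul]
    refine Finset.sum_eq_zero fun i _ => ?_
    by_cases hi : p i = 0
    · rw [hi, zero_mul]
    have h1 := wMixed_one_ne hd i hi
    have h2 : ψ i (1, 0) = 0 := by
      refine hd.eq_zero ?_ i hi
      rw [wMixed_apply_of_ne _ _ _ (Or.inl (by simp)), wState_one, if_pos rfl, zero_mul]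
    rw [pureConcurrence_eq (hd.norm_eq_one i), sum_one_of_ne h1, marginal_zero_one_of_ne h1, h2]
    simp
  · have ha' : ‖a‖ ≠ 0 := norm_ne_zero_iff.2 ha
    apply mul_left_cancel₀ ha'
    rw [Finset.mul_sum]
    calc ∑ i, ‖a‖ * (p i * pureConcurrence (ψ i))
        = ∑ i, 2 * √(∑ j, ‖b j‖ ^ 2) * (p i * ‖ψ i (1, 0)‖ ^ 2) := by
          refine Finset.sum_congr rfl fun i _ => ?_
          by_cases hi : p i = 0
          · simp [hi]
          · linear_combination p i * pureConcurrence_of_decomposition hd i hi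
      _ = _ := by
          rw [← Finset.mul_sum, sum_weight_one hd]
          ring

theorem concurrence_wMixed {a : ℂ} {b : ι → ℂ} {q : ℝ} (hq : 0 ≤ q)
    (h : ‖a‖ ^ 2 + ∑ i, ‖b i‖ ^ 2 + q = 1) :
    concurrence (wMixed a b q) = 2 * ‖a‖ * √(∑ j, ‖b j‖ ^ 2) := by
  obtain ⟨k, p, ψ, hd⟩ := exists_wMixed_isPureDecomposition hq h
  rw [concurrence, ← csInf_singleton (2 * ‖a‖ * √(∑ j, ‖b j‖ ^ 2))]
  congr 1
  ext c
  constructor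
  · rintro ⟨k, p, ψ, hd, rfl⟩
    exact sum_pureConcurrence hd
  · rintro rfl
    exact ⟨k, p, ψ, hd, (sum_pureConcurrence hd).symm⟩

/-- In the decomposition into `w` and the vacuum, the normalized `w` has diagonal marginal with
entry `A / (A + s)` and probability `A + s`. -/
theorem renyiWeight_le_renyiAssistance {α : ℝ} (h0 : 0 < α) (h2 : α ≤ 2) {a : ℂ} {b : ι → ℂ}
    {q : ℝ} (hq : 0 ≤ q) (h : ‖a‖ ^ 2 + ∑ i, ‖b i‖ ^ 2 + q = 1) :
    renyiWeight α (‖a‖ ^ 2) (∑ i, ‖b i‖ ^ 2) ≤ renyiAssistance α (wMixed a b q) := by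
  have hnn : ∀ {ψ : Fin 2 × (ι → Fin 2) → ℂ}, ∑ z, ‖ψ z‖ ^ 2 = 1 →
      0 ≤ pureRenyiEntanglement α ψ := by
    intro ψ hψ
    obtain ⟨l, hl, e, -⟩ := exists_pureRenyiEntanglement_eq α hψ
    rw [e]
    exact binaryRenyi_nonneg h0 h2 hl
  have hw : 0 ≤ ‖a‖ ^ 2 + ∑ i, ‖b i‖ ^ 2 := by positivity
  rcases hw.eq_or_lt with hw | hw
  · rw [renyiWeight, ← hw, zero_mul]
    refine Real.sSup_nonneg ?_
    rintro e ⟨k, p, ψ, hd, rfl⟩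
    exact Finset.sum_nonneg fun i _ => mul_nonneg (hd.nonneg i) (hnn (hd.norm_eq_one i))
  · have hd := wMixed_isPureDecomposition hq h hw
    refine le_trans ?_ (le_csSup (renyiAssistance_bddAbove h0 h2 _) ⟨_, _, _, hd, rfl⟩)
    rw [Fin.sum_univ_two]
    simp only [Matrix.cons_val_zero, Matrix.cons_val_one]
    have hv := mul_nonneg hq (hnn (sum_norm_vacuum (ι := ι)))
    refine le_add_of_le_of_nonneg (le_of_eq ?_) hv
    rw [renyiWeight]
    congr 1
    have hne : ∀ y : ι → Fin 2, y ≠ 0 →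
        (((√(‖a‖ ^ 2 + ∑ i, ‖b i‖ ^ 2))⁻¹ : ℝ) : ℂ) • wState a b (1, y) = 0 := by
      intro y hy
      rw [wState_one, if_neg hy, smul_zero]
    have hone := sum_one_of_ne (ψ := fun z =>
      (((√(‖a‖ ^ 2 + ∑ i, ‖b i‖ ^ 2))⁻¹ : ℝ) : ℂ) • wState a b z) hne
    have hmar := marginal_zero_one_of_ne (ψ := fun z =>
      (((√(‖a‖ ^ 2 + ∑ i, ‖b i‖ ^ 2))⁻¹ : ℝ) : ℂ) • wState a b z) hne
    rw [wState_zero_zero, smul_zero, zero_mul] at hmar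
    rw [pureRenyiEntanglement_of_marginal_eq_zero α (sum_norm_smul_wState a b hw) hmar, hone,
      wState_one, if_pos rfl, norm_smul, mul_pow, Complex.norm_real, Real.norm_eq_abs, sq_abs,
      inv_pow, Real.sq_sqrt hw.le, div_eq_inv_mul]

/-- Jensen's inequality for `binaryRenyi`: the excitation probabilities of `A` in the members
average to `|a|²`. -/
theorem renyiAssistance_wDensity_le {α : ℝ} (h0 : 0 < α) (h2 : α ≤ 2) {a : ℂ} {b : ι → ℂ}
    (h : ‖a‖ ^ 2 + ∑ i, ‖b i‖ ^ 2 = 1) :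
    renyiAssistance α (wDensity a b) ≤ renyiWeight α (‖a‖ ^ 2) (∑ i, ‖b i‖ ^ 2) := by
  refine Real.sSup_le ?_ (renyiWeight_nonneg h0 h2 (by positivity) (by positivity))
  rw [renyiWeight, h, one_mul, div_one, ← wMixed_zero]
  rintro e ⟨k, p, ψ, hd, rfl⟩
  have hmem : ∀ i, ∑ y, ‖ψ i (1, y)‖ ^ 2 ∈ Set.Icc (0 : ℝ) 1 := fun i =>
    ⟨by positivity, by
      have := sum_add_sum_eq_one (hd.norm_eq_one i)
      have h' : 0 ≤ ∑ y, ‖ψ i (0, y)‖ ^ 2 := by positivity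
      linarith⟩
  -- With no vacuum term in `ρ`, the members have no vacuum amplitude, so their marginals are
  -- diagonal.
  have key : ∀ i, p i ≠ 0 → marginal (ψ i) 0 1 = 0 := by
    intro i hi
    have hz : ψ i (0, 0) = 0 := by
      refine hd.eq_zero ?_ i hi
      simp [wMixed_zero, wDensity, pureDensity, Matrix.vecMulVec_apply, wState_zero_zero]
    rw [marginal_zero_one_of_ne (wMixed_one_ne hd i hi), hz, zero_mul]
  calc ∑ i, p i * pureRenyiEntanglement α (ψ i)
      = ∑ i, p i • binaryRenyi α (∑ y, ‖ψ i (1, y)‖ ^ 2) := by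
        refine Finset.sum_congr rfl fun i _ => ?_
        by_cases hi : p i = 0
        · simp [hi]
        · rw [pureRenyiEntanglement_of_marginal_eq_zero α (hd.norm_eq_one i) (key i hi),
            smul_eq_mul]
    _ ≤ binaryRenyi α (∑ i, p i • ∑ y, ‖ψ i (1, y)‖ ^ 2) :=
        (binaryRenyi_concaveOn h0 h2).le_map_sum (fun i _ => hd.nonneg i) hd.sum_eq_one
          fun i _ => hmem i
    _ = binaryRenyi α (‖a‖ ^ 2) := by
        rw [← sum_weight_one hd]
        congr 1
        refine Finset.sum_congr rfl fun i _ => ?_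
        by_cases hi : p i = 0
        · simp [hi]
        · rw [sum_one_of_ne (wMixed_one_ne hd i hi), smul_eq_mul]

theorem norm_sq_add_sum_subtype {a : ℂ} {b : ι → ℂ} (S : Finset ι)
    (h : ‖a‖ ^ 2 + ∑ i, ‖b i‖ ^ 2 = 1) :
    ‖a‖ ^ 2 + ∑ i : S, ‖b i‖ ^ 2 + ∑ i : {i // i ∉ S}, ‖b i‖ ^ 2 = 1 := by
  rw [← h, add_assoc, ← Fintype.sum_subtype_add_sum_subtype (fun i => i ∈ S)]
  congr!

theorem concurrence_reduceTo {a : ℂ} {b : ι → ℂ} (S : Finset ι)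
    (h : ‖a‖ ^ 2 + ∑ i, ‖b i‖ ^ 2 = 1) :
    concurrence (reduceTo S (wDensity a b)) = 2 * ‖a‖ * √(∑ i ∈ S, ‖b i‖ ^ 2) := by
  rw [reduceTo_wDensity, concurrence_wMixed (by positivity) (norm_sq_add_sum_subtype S h),
    Finset.sum_coe_sort S fun i => ‖b i‖ ^ 2]

theorem renyiWeight_le_reduceTo {α : ℝ} (h0 : 0 < α) (h2 : α ≤ 2) {a : ℂ} {b : ι → ℂ}
    (S : Finset ι) (h : ‖a‖ ^ 2 + ∑ i, ‖b i‖ ^ 2 = 1) :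
    renyiWeight α (‖a‖ ^ 2) (∑ i ∈ S, ‖b i‖ ^ 2) ≤
      renyiAssistance α (reduceTo S (wDensity a b)) := by
  rw [reduceTo_wDensity, ← Finset.sum_coe_sort S fun i => ‖b i‖ ^ 2]
  exact renyiWeight_le_renyiAssistance h0 h2 (by positivity) (norm_sq_add_sum_subtype S h)

/-- The order of the concurrences is that of the weights `renyiWeight`. -/
theorem renyiWeight_le_of_concurrence_le {α : ℝ} (h0 : 0 < α) (h2 : α ≤ 2) {a : ℂ} {b : ι → ℂ}
    {S T : Finset ι} (h : ‖a‖ ^ 2 + ∑ i, ‖b i‖ ^ 2 = 1)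
    (hle : concurrence (reduceTo S (wDensity a b)) ≤ concurrence (reduceTo T (wDensity a b))) :
    renyiWeight α (‖a‖ ^ 2) (∑ i ∈ S, ‖b i‖ ^ 2) ≤
      renyiWeight α (‖a‖ ^ 2) (∑ i ∈ T, ‖b i‖ ^ 2) := by
  rw [concurrence_reduceTo S h, concurrence_reduceTo T h] at hle
  -- For `a = 0` all concurrences vanish and say nothing about the sums, but the weights vanish too.
  rcases eq_or_ne a 0 with rfl | ha
  · simp [renyiWeight, binaryRenyi_zero h0]
  · have ha' : 0 < 2 * ‖a‖ := by positivity
    refine renyiWeight_mono h0 h2 (by positivity) (by positivity) ?_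
    exact (Real.sqrt_le_sqrt_iff (by positivity)).1 (le_of_mul_le_mul_left hle ha')

end WMixed

end WPolygamy

end

/-! ### Assembly of the weighted bound. -/

namespace WPolygamy

theorem sum_filter_fin_eq_sum_nat {M : ℕ} (P : ℕ → Prop) [DecidablePred P] (f : ℕ → ℝ)
    {s : Finset ℕ} (hs : ∀ k, k ∈ s ↔ k < M ∧ P k) :
    ∑ i ∈ Finset.univ.filter (fun i : Fin M => P i), f i = ∑ k ∈ s, f k := by
  have h : s = (Finset.range M).filter P := by
    ext k
    simp [hs]
  rw [h, Finset.sum_filter, Finset.sum_filter]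
  exact Fin.sum_univ_eq_sum_range (fun k => if P k then f k else 0) M

/-- A sequence version of the weighted bound, with its comparison to the unweighted one. -/
theorem rpow_le_weighted_sum {μ : ℝ} (h0 : 0 ≤ μ) (h1 : μ ≤ 1) {x e T : ℕ → ℝ}
    (hT : ∀ k, 0 ≤ T k) (hx : ∀ k, 0 ≤ x k) (hxe : ∀ k, x k ≤ e k) {m n : ℕ} (hmn : m ≤ n)
    (hadd : ∀ k < n, T k ≤ x k + T (k + 1)) (hge : ∀ k < m, T (k + 1) ≤ x k)
    (hle : ∀ k, m ≤ k → k < n → x k ≤ T (k + 1)) (hlast : T n ≤ x n) :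
    T 0 ^ μ ≤ ∑ k ∈ Finset.range m, ((2 : ℝ) ^ μ - 1) ^ k * e k ^ μ +
      ((2 : ℝ) ^ μ - 1) ^ (m + 1) * ∑ k ∈ Finset.Ico m n, e k ^ μ +
      ((2 : ℝ) ^ μ - 1) ^ m * e n ^ μ := by
  have hκ : (0 : ℝ) ≤ 2 ^ μ - 1 := sub_nonneg.2 (Real.one_le_rpow one_le_two h0)
  have hp : ∀ k, x k ^ μ ≤ e k ^ μ := fun k => Real.rpow_le_rpow (hx k) (hxe k) h0
  have s1 := rpow_le_sum_range_of_ge h0 h1 hT m (fun k hk => hadd k (by omega)) hge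
  have s2 := rpow_le_sum_Ico_of_le h0 h1 hT hx hmn (fun k _ hk => hadd k hk) hle
  have s3 : T n ^ μ ≤ e n ^ μ := (Real.rpow_le_rpow (hT n) hlast h0).trans (hp n)
  -- The order relations concern the weights `x` and `T`, so `x` is replaced by the larger `e` only
  -- after peeling; the coefficients are nonnegative.
  have s4 : ∑ k ∈ Finset.range m, ((2 : ℝ) ^ μ - 1) ^ k * x k ^ μ ≤
      ∑ k ∈ Finset.range m, ((2 : ℝ) ^ μ - 1) ^ k * e k ^ μ :=
    Finset.sum_le_sum fun k _ => mul_le_mul_of_nonneg_left (hp k) (pow_nonneg hκ k)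
  have s5 : ∑ k ∈ Finset.Ico m n, x k ^ μ ≤ ∑ k ∈ Finset.Ico m n, e k ^ μ :=
    Finset.sum_le_sum fun k _ => hp k
  have s6 := mul_le_mul_of_nonneg_left
    (s2.trans (add_le_add (mul_le_mul_of_nonneg_left s5 hκ) s3)) (pow_nonneg hκ m)
  rw [pow_succ]
  linarith

/-- All coefficients are powers of `2^μ - 1`, which lies in `[0, 1]`. -/
theorem weighted_sum_le_sum {μ : ℝ} (h0 : 0 ≤ μ) (h1 : μ ≤ 1) {e : ℕ → ℝ}
    (he : ∀ k, 0 ≤ e k) {m n : ℕ} (hmn : m ≤ n) :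
    ∑ k ∈ Finset.range m, ((2 : ℝ) ^ μ - 1) ^ k * e k ^ μ +
      ((2 : ℝ) ^ μ - 1) ^ (m + 1) * ∑ k ∈ Finset.Ico m n, e k ^ μ +
      ((2 : ℝ) ^ μ - 1) ^ m * e n ^ μ ≤ ∑ k ∈ Finset.range (n + 1), e k ^ μ := by
  have hκ : (0 : ℝ) ≤ 2 ^ μ - 1 := sub_nonneg.2 (Real.one_le_rpow one_le_two h0)
  have hκ1 : (2 : ℝ) ^ μ - 1 ≤ 1 := by
    have := Real.rpow_le_rpow_of_exponent_le one_le_two h1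
    rw [Real.rpow_one] at this
    linarith
  have hp : ∀ k, 0 ≤ e k ^ μ := fun k => Real.rpow_nonneg (he k) μ
  have hc : ∀ (k : ℕ) {t : ℝ}, 0 ≤ t → ((2 : ℝ) ^ μ - 1) ^ k * t ≤ t := fun k t ht =>
    mul_le_of_le_one_left ht (pow_le_one₀ hκ hκ1)
  rw [Finset.sum_range_succ, ← Finset.sum_range_add_sum_Ico _ hmn]
  exact add_le_add (add_le_add (Finset.sum_le_sum fun k _ => hc k (hp k))
    (hc _ (Finset.sum_nonneg fun k _ => hp k))) (hc _ (hp n))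

end WPolygamy

open WPolygamy in
/-- The qubits are `A, B_1, …, B_{N-1}`; the index `i : Fin (N - 1)` stands for `B_{i+1}`.
The second conjunct says that the bound is at least as tight as the unweighted one. -/
theorem theorem3 (N m : ℕ) (hN : 4 ≤ N) (hm : 1 ≤ m) (hmN : m + 3 ≤ N)
    (a : ℂ) (b : Fin (N - 1) → ℂ) (hab : ‖a‖ ^ 2 + ∑ i, ‖b i‖ ^ 2 = 1)
    (h_ge : ∀ i : Fin (N - 1), (i : ℕ) < m →
      concurrence (reduceTo {i} (wDensity a b)) ≥
        concurrence (reduceTo (Finset.Ioi i) (wDensity a b)))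
    (h_le : ∀ j : Fin (N - 1), m ≤ (j : ℕ) → (j : ℕ) < N - 2 →
      concurrence (reduceTo {j} (wDensity a b)) ≤
        concurrence (reduceTo (Finset.Ioi j) (wDensity a b)))
    (μ : ℝ) (hμ : μ ∈ Set.Icc (0 : ℝ) 1)
    (α : ℝ) (hα : α ∈ Set.Icc ((Real.sqrt 7 - 1) / 2) ((Real.sqrt 13 - 1) / 2)) :
    renyiAssistance α (wDensity a b) ^ μ ≤
        ∑ i ∈ Finset.univ.filter (fun i : Fin (N - 1) => (i : ℕ) < m),
            ((2 : ℝ) ^ μ - 1) ^ (i : ℕ) * renyiAssistance α (reduceTo {i} (wDensity a b)) ^ μ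
          + ((2 : ℝ) ^ μ - 1) ^ (m + 1) *
            ∑ i ∈ Finset.univ.filter (fun i : Fin (N - 1) => m ≤ (i : ℕ) ∧ (i : ℕ) < N - 2),
              renyiAssistance α (reduceTo {i} (wDensity a b)) ^ μ
          + ((2 : ℝ) ^ μ - 1) ^ m *
            renyiAssistance α (reduceTo {(⟨N - 2, by omega⟩ : Fin (N - 1))} (wDensity a b)) ^ μ ∧
      ∑ i ∈ Finset.univ.filter (fun i : Fin (N - 1) => (i : ℕ) < m),
            ((2 : ℝ) ^ μ - 1) ^ (i : ℕ) * renyiAssistance α (reduceTo {i} (wDensity a b)) ^ μ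
          + ((2 : ℝ) ^ μ - 1) ^ (m + 1) *
            ∑ i ∈ Finset.univ.filter (fun i : Fin (N - 1) => m ≤ (i : ℕ) ∧ (i : ℕ) < N - 2),
              renyiAssistance α (reduceTo {i} (wDensity a b)) ^ μ
          + ((2 : ℝ) ^ μ - 1) ^ m *
            renyiAssistance α (reduceTo {(⟨N - 2, by omega⟩ : Fin (N - 1))} (wDensity a b)) ^ μ ≤
        ∑ i : Fin (N - 1), renyiAssistance α (reduceTo {i} (wDensity a b)) ^ μ := by
  obtain ⟨hμ0, hμ1⟩ := hμ
  have h0 : 0 < α := by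
    have : (1 : ℝ) < √7 := Real.lt_sqrt_of_sq_lt (by norm_num)
    linarith [hα.1]
  have h2 : α ≤ 2 := by
    have : √13 ≤ (5 : ℝ) := Real.sqrt_le_iff.2 (by norm_num)
    linarith [hα.2]
  -- `e` holds the assistances, `x` the single-qubit weights and `T` the tail weights. Both `e` and
  -- `x` are padded by `0`, so that their inequalities hold at every natural index.
  set e : ℕ → ℝ := fun k =>
    if h : k < N - 1 then renyiAssistance α (reduceTo {(⟨k, h⟩ : Fin (N - 1))} (wDensity a b))
    else 0 with he
  set x : ℕ → ℝ := fun k =>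
    if h : k < N - 1 then renyiWeight α (‖a‖ ^ 2) (‖b ⟨k, h⟩‖ ^ 2) else 0 with hx
  set T : ℕ → ℝ := fun k => renyiWeight α (‖a‖ ^ 2)
    (∑ j ∈ Finset.univ.filter (fun j : Fin (N - 1) => k ≤ j), ‖b j‖ ^ 2) with hT
  have heq : ∀ i : Fin (N - 1), renyiAssistance α (reduceTo {i} (wDensity a b)) = e i := by
    intro i
    simp [he]
  have hxeq : ∀ i : Fin (N - 1), x i = renyiWeight α (‖a‖ ^ 2) (∑ j ∈ {i}, ‖b j‖ ^ 2) := by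
    intro i
    simp [hx]
  have hx0 : ∀ k, 0 ≤ x k := by
    intro k
    simp only [hx]
    split_ifs
    · exact renyiWeight_nonneg h0 h2 (by positivity) (by positivity)
    · exact le_rfl
  have hxe : ∀ k, x k ≤ e k := by
    intro k
    by_cases hk : k < N - 1
    · have := renyiWeight_le_reduceTo h0 h2 {(⟨k, hk⟩ : Fin (N - 1))} hab
      rwa [← hxeq, heq] at this
    · simp [hx, he, hk]
  have hT0 : ∀ k, 0 ≤ T k := fun k =>
    renyiWeight_nonneg h0 h2 (by positivity) (by positivity)
  -- Index `i` is the qubit `B_{i+1}`, so `T (i + 1)` is the weight of the qubits strictly after it,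
  -- as in the concurrence hypotheses.
  have hTsucc : ∀ i : Fin (N - 1), T (i + 1) =
      renyiWeight α (‖a‖ ^ 2) (∑ j ∈ Finset.Ioi i, ‖b j‖ ^ 2) := by
    intro i
    have : Finset.univ.filter (fun j : Fin (N - 1) => (i : ℕ) + 1 ≤ j) = Finset.Ioi i := by
      ext j
      simp
    simp only [hT, this]
  have hadd : ∀ i : Fin (N - 1), T i ≤ x i + T (i + 1) := by
    intro i
    have : Finset.univ.filter (fun j : Fin (N - 1) => (i : ℕ) ≤ j) =
        Finset.cons i (Finset.Ioi i) (by simp) := by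
      ext j
      simp [le_iff_eq_or_lt, Fin.ext_iff]
    rw [hTsucc, hxeq, Finset.sum_singleton]
    simp only [hT, this, Finset.sum_cons]
    exact renyiWeight_subadditive h0 h2 (by positivity) (by positivity) (by positivity)
  -- The last tail is the single qubit `B_{N-1}`, at index `N - 2`.
  have hlast : T (N - 2) ≤ x (N - 2) := by
    have h := hxeq ⟨N - 2, by omega⟩
    have : Finset.univ.filter (fun j : Fin (N - 1) => N - 2 ≤ (j : ℕ)) = {⟨N - 2, by omega⟩} := by
      ext j
      simp only [Finset.mem_filter, Finset.mem_univ, true_and, Finset.mem_singleton, Fin.ext_iff]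
      omega
    simp only [hT, this]
    exact h.ge
  have hfirst : renyiAssistance α (wDensity a b) ≤ T 0 := by
    have := renyiAssistance_wDensity_le h0 h2 hab
    simpa [hT] using this
  have hfirst0 : 0 ≤ renyiAssistance α (wDensity a b) := by
    rw [← wMixed_zero]
    exact (renyiWeight_nonneg h0 h2 (by positivity) (by positivity)).trans
      (renyiWeight_le_renyiAssistance h0 h2 le_rfl (by simpa using hab))
  simp only [heq]
  rw [sum_filter_fin_eq_sum_nat (fun k => k < m) (fun k => ((2 : ℝ) ^ μ - 1) ^ k * e k ^ μ)
      (s := Finset.range m) (by intro k; simp only [Finset.mem_range]; omega),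
    sum_filter_fin_eq_sum_nat (fun k => m ≤ k ∧ k < N - 2) (fun k => e k ^ μ)
      (s := Finset.Ico m (N - 2)) (by intro k; simp only [Finset.mem_Ico]; omega),
    Fin.sum_univ_eq_sum_range (fun k => e k ^ μ) (N - 1)]
  constructor
  · refine (Real.rpow_le_rpow hfirst0 hfirst hμ0).trans
      (rpow_le_weighted_sum hμ0 hμ1 hT0 hx0 hxe (by omega) ?_ ?_ ?_ hlast)
    · exact fun k hk => hadd ⟨k, by omega⟩
    · intro k hk
      have h := renyiWeight_le_of_concurrence_le h0 h2 hab (h_ge ⟨k, by omega⟩ hk)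
      rwa [← hTsucc, ← hxeq] at h
    · intro k hk hk'
      have h := renyiWeight_le_of_concurrence_le h0 h2 hab (h_le ⟨k, by omega⟩ hk hk')
      rwa [← hTsucc, ← hxeq] at h
  · have h := weighted_sum_le_sum hμ0 hμ1 (fun k => (hx0 k).trans (hxe k))
      (show m ≤ N - 2 by omega)
    rwa [show N - 2 + 1 = N - 1 by omega] at h
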